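/- Let $1\le p<\infty$. For $x\in\mathbb{R}^2$ and $h>0$ put $Q_{x,h}=[x_1,x_1+h)\times[x_2,x_2+h)$, and for a square $Q=Q_{a,h}$ put $Q^+=Q_{(a_1+h,\,a_2+h),\,h}$. Let $$M^+f(x)=\sup_{h>0}\frac1{|Q_{x,h}|}\int_{Q_{x,h}}|f(y)|\,dy .$$ For a nonnegative measurable function $u$ on $\mathbb{R}^2$ and a measurable set $A$ write $u(A)=\int_A u\in[0,\infty]$. A pair $(w,v)$ of nonnegative (finite-valued) measurable functions on $\mathbb{R}^2$ belongs to $A_p^+(\mathcal{R})$ if there is a constant $0<K<\infty$ such that $$\frac{|E|}{|Q|}\,w(Q)^{1/p}\le K\,v(E)^{1/p}\qquad(\text{with } 0\cdot\infty=0)$$ for every square $Q$ with sides parallel to the axes and every measurable set $E\subset Q^+$; the infimum of such $K$ is denoted by $[(w,v)]_{A_p^+(\mathcal{R})}$. **Theorem.** For every pair $(w,v)$ of nonnegative measurable functions on $\mathbb{R}^2$ the following are equivalent: (a) $M^+$ is of restricted weak $(p,p)$ type with respect to $(w,v)$, that is, there is a constant $0<B<\infty$ such that $$w\left(\{x\in\mathbb{R}^2: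 M^+(\mathcal{X}_E)(x)>t\}\right)\le\frac{B}{t^p}\,v(E)$$ for every $t>0$ and every measurable set $E\subset\mathbb{R}^2$; (b) $(w,v)\in A_p^+(\mathcal{R})$. Moreover, in this case (a) holds with $B$ replaced by $C\,[(w,v)]_{A_p^+(\mathcal{R})}^p$, where $C>0$ depends only on $p$: $$w\left(\{x\in\mathbb{R}^2: M^+(\mathcal{X}_E)(x)>t\}\right)\le\frac{C\,[(w,v)]_{A_p^+(\mathcal{R})}^p}{t^p}\,v(E)$$ for every $t>0$ and every measurable set $E\subset\mathbb{R}^2$. -/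

import Mathlib

open MeasureTheory
open scoped NNReal ENNReal

noncomputable section

namespace OneSided

variable {n : ℕ}

/-- The half-open cube `∏ i, [x i, x i + h)` with lower-left corner `x` and side length `h`. -/
def cube (x : Fin n → ℝ) (h : ℝ) : Set (Fin n → ℝ) :=
  Set.univ.pi fun i => Set.Ico (x i) (x i + h)

/-- For the cube `Q = ∏ i, [a i, b i)` with `b i = a i + h`, this is the translate
`Q⁺ = ∏ i, [b i, 2 * b i - a i)`. -/
def cubePlus (a : Fin n → ℝ) (h : ℝ) : Set (Fin n → ℝ) :=
  cube (fun i => a i + h) h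

/-- The one-sided Hardy-Littlewood maximal operator
`M⁺ f x = sup_{h > 0} |Q_{x,h}|⁻¹ ∫_{Q_{x,h}} |f|`, with values in `[0, ∞]`. -/
def maximalPlus (f : (Fin n → ℝ) → ℝ) (x : Fin n → ℝ) : ℝ≥0∞ :=
  ⨆ (h : ℝ) (_ : 0 < h), (volume (cube x h))⁻¹ * ∫⁻ y in cube x h, ‖f y‖ₑ

/-- `w(A) = ∫_A w`, with values in `[0, ∞]`. -/
def weight (w : (Fin n → ℝ) → ℝ≥0) (A : Set (Fin n → ℝ)) : ℝ≥0∞ :=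
  ∫⁻ x in A, (w x : ℝ≥0∞)

/-- `M⁺` satisfies the restricted weak type `(p,p)` inequality with respect to `(w, v)` with
constant `C`: `w({M⁺ χ_E > t}) ≤ (C / t ^ p) v(E)` for every `t > 0` and every Lebesgue measurable
set `E` (`NullMeasurableSet` with respect to `volume` is Lebesgue measurability). -/
def RestrictedWeakTypeWith (p : ℝ) (w v : (Fin n → ℝ) → ℝ≥0) (C : ℝ≥0∞) : Prop :=
  ∀ t : ℝ≥0, 0 < t → ∀ E : Set (Fin n → ℝ), NullMeasurableSet E volume →
    weight w {x | (t : ℝ≥0∞) < maximalPlus (E.indicator 1) x} ≤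
      C / (t : ℝ≥0∞) ^ p * weight v E

/-- `M⁺` is of restricted weak type `(p,p)` with respect to `(w, v)`. -/
def RestrictedWeakType (p : ℝ) (w v : (Fin n → ℝ) → ℝ≥0) : Prop :=
  ∃ C : ℝ≥0, 0 < C ∧ RestrictedWeakTypeWith p w v C

/-- The inequality `|E| / |Q| ≤ C (v(E) / w(Q)) ^ (1/p)` for all cubes `Q` and all Lebesgue
measurable `E ⊆ Q⁺`. It is written with `w(Q)` on the left-hand side (and `0 * ∞ = 0`), so that no
quotient `0 / 0` or `∞ / ∞` occurs. -/
def ApPlusRestrictedWith (p : ℝ) (w v : (Fin n → ℝ) → ℝ≥0) (C : ℝ≥0) : Prop :=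
  ∀ (a : Fin n → ℝ) (h : ℝ), 0 < h → ∀ E : Set (Fin n → ℝ), NullMeasurableSet E volume →
    E ⊆ cubePlus a h →
      volume E / volume (cube a h) * weight w (cube a h) ^ (1 / p) ≤
        (C : ℝ≥0∞) * weight v E ^ (1 / p)

/-- The class `A_p⁺(R)` of pairs of weights. -/
def ApPlusRestricted (p : ℝ) (w v : (Fin n → ℝ) → ℝ≥0) : Prop :=
  ∃ C : ℝ≥0, 0 < C ∧ ApPlusRestrictedWith p w v C

/-- The smallest admissible constant `[(w, v)]` in the `A_p⁺(R)` condition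
(`∞` if there is none). -/
def apPlusConst (p : ℝ) (w v : (Fin n → ℝ) → ℝ≥0) : ℝ≥0∞ :=
  ⨅ (C : ℝ≥0) (_ : ApPlusRestrictedWith p w v C), (C : ℝ≥0∞)

end OneSided

end

open MeasureTheory
open scoped NNReal ENNReal

namespace OneSided

/-! Necessity is a test: for `x` in `Q` of side `h`, the square `Q_{x,2h}` contains `Q⁺`, so `M⁺
χ_E` is at least `|E| / (4|Q|)` on `Q` for every `E ⊆ Q⁺`.

For sufficiency, fix a level `t < M⁺ χ_E ≤ 4t`. At such a point `x` some square `Q_{x,h}` has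
density above `t`, while `Q_{x,h/4}` holds at most a quarter of `t h²`. Hence a fixed part of the
mass lies beyond `h/4` in one direction `j`. If `B` is a dyadic square of side `r ~ h/4` containing
`x`, this mass lies above `B` in direction `j` and to the right of `x` in the other direction `i`.
Cutting it by a line `z i = a` of prescribed mass puts the relevant points of `B` in a square of
side `10r` whose diagonal successor contains the cut set (`exists_piece_cover`). A small subset `F`
of the cut set then controls the `w`-mass, by `A_p⁺(R)`.

The sets `F` for different `B` must be disjoint if their `v`-masses are to add up to at most `v(E)`.
The same square of side `10r` also contains the lower-left diagonal neighbour of `B`, its shadow, so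
dyadic squares in the shadow of a selected one can be discarded. The selected squares satisfy a
Carleson packing bound (`ShadowFree.sum_sq_le`). As each `F` has small area, the sets already chosen
near `B` leave enough of `E` to choose from (`exists_disjoint_assignment`). Summing over the levels
`4^l t` gives a convergent geometric series. -/

/-! ### Cubes, weights and cutting a set by a half-plane -/

theorem measurableSet_cube {n : ℕ} (x : Fin n → ℝ) (h : ℝ) : MeasurableSet (cube x h) :=
  MeasurableSet.univ_pi fun _ => measurableSet_Ico

theorem mem_cube {n : ℕ} {x z : Fin n → ℝ} {h : ℝ} :
    z ∈ cube x h ↔ ∀ i, x i ≤ z i ∧ z i < x i + h := by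
  simp [cube, Set.mem_pi, Set.mem_Ico]

theorem volume_cube (x : Fin 2 → ℝ) (h : ℝ) : volume (cube x h) = ENNReal.ofReal h ^ 2 := by
  rw [cube, Real.volume_pi_Ico]
  simp

theorem volume_cube_ne_top (x : Fin 2 → ℝ) (h : ℝ) : volume (cube x h) ≠ ∞ := by
  rw [volume_cube]
  exact ENNReal.pow_ne_top ENNReal.ofReal_ne_top

theorem volume_real_cube (x : Fin 2 → ℝ) {h : ℝ} (hh : 0 ≤ h) :
    volume.real (cube x h) = h ^ 2 := by
  rw [Measure.real, volume_cube, ENNReal.toReal_pow, ENNReal.toReal_ofReal hh]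

theorem weight_eq {n : ℕ} (w : (Fin n → ℝ) → ℝ≥0) (A : Set (Fin n → ℝ)) :
    weight w A = volume.withDensity (fun x => (w x : ℝ≥0∞)) A :=
  (withDensity_apply' _ _).symm

theorem weight_mono {n : ℕ} (w : (Fin n → ℝ) → ℝ≥0) {A B : Set (Fin n → ℝ)} (h : A ⊆ B) :
    weight w A ≤ weight w B := by
  simpa only [weight_eq] using measure_mono h

/-- The mass of a bounded set in a half-space takes every intermediate value. -/
theorem exists_halfSpace_volume_eq {A : Set (Fin 2 → ℝ)} {y : Fin 2 → ℝ} {H : ℝ} (hH : 0 ≤ H)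
    (hAy : A ⊆ cube y H) (i : Fin 2) {s : ℝ} (hs : 0 ≤ s)
    (hsA : s ≤ volume.real A) :
    ∃ a, y i ≤ a ∧ a ≤ y i + H ∧ volume.real (A ∩ {z | a ≤ z i}) = s := by
  set g : ℝ → ℝ := fun a => volume.real (A ∩ {z | a ≤ z i}) with hg
  have hfin : ∀ T ⊆ A, volume T ≠ ∞ := fun T hT =>
    ne_top_of_le_ne_top (volume_cube_ne_top y H) (measure_mono (hT.trans hAy))
  -- A strip of width `b - a` in a square of side `H` has area `H * (b - a)`, so `g` is Lipschitz
  -- and the intermediate value theorem applies.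
  have key : ∀ a b, a ≤ b → g a ≤ g b + H * (b - a) := by
    intro a b hab
    set R : Set (Fin 2 → ℝ) := Set.univ.pi fun l =>
      Set.Ico (if l = i then a else y l) (if l = i then b else y l + H) with hR
    have hRv : volume R = ENNReal.ofReal (H * (b - a)) := by
      rw [hR, Real.volume_pi_Ico, Fin.prod_univ_two]
      rw [ENNReal.ofReal_mul hH]
      fin_cases i <;> simp [mul_comm]
    have hsub : A ∩ {z | a ≤ z i} ⊆ (A ∩ {z | b ≤ z i}) ∪ R := by
      rintro z ⟨hzA, hza⟩
      by_cases hzb : b ≤ z i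
      · exact Or.inl ⟨hzA, hzb⟩
      · right
        have hz := mem_cube.1 (hAy hzA)
        simp only [hR, Set.mem_pi, Set.mem_univ, true_imp_iff, Set.mem_Ico]
        intro l
        by_cases hl : l = i
        · subst hl
          simpa using ⟨hza, not_le.1 hzb⟩
        · simpa [hl] using hz l
    have hne : volume ((A ∩ {z | b ≤ z i}) ∪ R) ≠ ∞ :=
      (measure_union_lt_top (hfin _ Set.inter_subset_left).lt_top
        (by rw [hRv]; exact ENNReal.ofReal_lt_top)).ne
    calc g a ≤ volume.real ((A ∩ {z | b ≤ z i}) ∪ R) := measureReal_mono hsub hne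
      _ ≤ g b + volume.real R := measureReal_union_le _ _
      _ = g b + H * (b - a) := by
        rw [measureReal_def (s := R), hRv, ENNReal.toReal_ofReal (mul_nonneg hH (by linarith))]
  have hanti : Antitone g := fun a b hab =>
    measureReal_mono (fun z hz => ⟨hz.1, le_trans hab hz.2⟩) (hfin _ Set.inter_subset_left)
  have hcont : Continuous g := by
    have : LipschitzWith H.toNNReal g := by
      refine LipschitzWith.of_dist_le_mul fun a b => ?_
      rw [Real.coe_toNNReal _ hH, Real.dist_eq, Real.dist_eq]
      rcases le_total a b with hab | hab
      · rw [abs_of_nonneg (sub_nonneg.2 (hanti hab)), abs_of_nonpos (by linarith)]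
        linarith [key a b hab]
      · rw [abs_of_nonpos (sub_nonpos.2 (hanti hab)), abs_of_nonneg (by linarith)]
        linarith [key b a hab]
    exact this.continuous
  have h0 : g (y i) = volume.real A := by
    simp only [hg]
    congr 1
    exact Set.inter_eq_left.2 fun z hz => (mem_cube.1 (hAy hz) i).1
  have h1 : g (y i + H) = 0 := by
    simp only [hg]
    have : A ∩ {z | y i + H ≤ z i} = ∅ := by
      ext z
      simp only [Set.mem_inter_iff, Set.mem_ofPred_eq, Set.mem_empty_iff_false, iff_false, not_and,
        not_le]
      exact fun hz => (mem_cube.1 (hAy hz) i).2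
    rw [this, measureReal_empty]
  obtain ⟨a, ha, hga⟩ := intermediate_value_Icc' (show y i ≤ y i + H by linarith)
    hcont.continuousOn ⟨h1.trans_le hs, hsA.trans_eq h0.symm⟩
  exact ⟨a, ha.1, ha.2, hga⟩

theorem exists_subset_volume_eq {A : Set (Fin 2 → ℝ)} {y : Fin 2 → ℝ} {H : ℝ} (hH : 0 ≤ H)
    (hA : MeasurableSet A) (hAy : A ⊆ cube y H) {s : ℝ} (hs : 0 ≤ s) (hsA : s ≤ volume.real A) :
    ∃ F ⊆ A, MeasurableSet F ∧ volume.real F = s := by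
  obtain ⟨a, -, -, ha⟩ := exists_halfSpace_volume_eq hH hAy 0 hs hsA
  exact ⟨_, Set.inter_subset_left, hA.inter (measurableSet_le measurable_const
    (measurable_pi_apply _)), ha⟩

/-! ### Local estimate on one square -/

/-- The `A_p⁺(R)` inequality solved for `w(Q)`. -/
theorem ApPlusRestrictedWith.weight_le {p : ℝ} (hp : 1 ≤ p) {w v : (Fin 2 → ℝ) → ℝ≥0} {K : ℝ≥0}
    (hK : ApPlusRestrictedWith p w v K) {a : Fin 2 → ℝ} {h : ℝ} (hh : 0 < h)
    {F : Set (Fin 2 → ℝ)} (hF : MeasurableSet F) (hFa : F ⊆ cubePlus a h) {q : ℝ} (hq : 0 < q)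
    (hqF : q * h ^ 2 ≤ volume.real F) :
    weight w (cube a h) ≤ ((K : ℝ≥0∞) / ENNReal.ofReal q) ^ p * weight v F := by
  have hp0 : 0 < p := by linarith
  have hFne : volume F ≠ ∞ := ne_top_of_le_ne_top (volume_cube_ne_top _ _) (measure_mono hFa)
  have h1 := hK a h hh F hF.nullMeasurableSet hFa
  have hv : volume (cube a h) = ENNReal.ofReal (h ^ 2) := by
    rw [volume_cube, ENNReal.ofReal_pow hh.le]
  have hq' : ENNReal.ofReal q ≤ volume F / volume (cube a h) := by
    rw [ENNReal.le_div_iff_mul_le (Or.inl (by rw [hv]; simp [hh.ne']))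
      (Or.inl (volume_cube_ne_top _ _)), hv, ← ENNReal.ofReal_mul hq.le]
    exact (ENNReal.ofReal_le_iff_le_toReal hFne).2 hqF
  have h2 : ENNReal.ofReal q * weight w (cube a h) ^ (1 / p) ≤ K * weight v F ^ (1 / p) :=
    (mul_le_mul_left hq' _).trans h1
  have h3 : weight w (cube a h) ^ (1 / p) ≤ K / ENNReal.ofReal q * weight v F ^ (1 / p) := by
    rw [mul_comm] at h2
    have := (ENNReal.le_div_iff_mul_le (Or.inl (by simpa using hq)) (Or.inl ENNReal.ofReal_ne_top)).2
      h2
    rwa [ENNReal.mul_div_right_comm] at this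
  have h4 := ENNReal.rpow_le_rpow h3 hp0.le
  rwa [ENNReal.mul_rpow_of_nonneg _ _ hp0.le, ← ENNReal.rpow_mul, ← ENNReal.rpow_mul,
    one_div_mul_cancel hp0.ne', ENNReal.rpow_one, ENNReal.rpow_one] at h4

/-- The set `G` stands for what has already been used up and is to be avoided. The shadow is
included only when `P` is nonempty, since a point of `P` is what guarantees mass `s` to cut off. -/
theorem exists_piece_cover {p : ℝ} (hp : 1 ≤ p) {w v : (Fin 2 → ℝ) → ℝ≥0} {K : ℝ≥0}
    (hK : ApPlusRestrictedWith p w v K) {A : Set (Fin 2 → ℝ)} (hA : MeasurableSet A)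
    {t r : ℝ} (ht : 0 < t) (hr : 0 < r) {i j : Fin 2} (hij : i ≠ j) (b : Fin 2 → ℝ)
    (hAb : A ⊆ cube b (9 * r)) (hAj : ∀ z ∈ A, b j + r ≤ z j)
    {G : Set (Fin 2 → ℝ)} (hG : MeasurableSet G)
    (hGb : volume.real (G ∩ cube b (9 * r)) ≤ t * r ^ 2) {s : ℝ} (hs : 3 * t * r ^ 2 ≤ s)
    {P : Set (Fin 2 → ℝ)} (hPb : P ⊆ cube b r)
    (hP : ∀ x ∈ P, s < volume.real (A ∩ {z | x i ≤ z i})) :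
    ∃ F ⊆ A \ G, MeasurableSet F ∧ volume.real F ≤ t * r ^ 2 / 200000 ∧
      weight w (P ∪ {z | z ∈ cube (fun l => b l - r) r ∧ P.Nonempty}) ≤
        ((K : ℝ≥0∞) / ENNReal.ofReal (t / 20000000)) ^ p * weight v F := by
  rcases P.eq_empty_or_nonempty with rfl | ⟨x₀, hx₀⟩
  · refine ⟨∅, by simp, MeasurableSet.empty, by simp; positivity, ?_⟩
    simp [weight]
  have hfin : ∀ T ⊆ A, volume T ≠ ∞ := fun T hT =>
    ne_top_of_le_ne_top (volume_cube_ne_top b (9 * r)) (measure_mono (hT.trans hAb))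
  have htr : 0 < t * r ^ 2 := by positivity
  have hs0 : 0 ≤ s := by nlinarith
  obtain ⟨a, hba, hab, ha⟩ := exists_halfSpace_volume_eq (by positivity : (0 : ℝ) ≤ 9 * r) hAb i
    hs0 ((hP x₀ hx₀).le.trans (measureReal_mono Set.inter_subset_left (hfin _ subset_rfl)))
  -- The half-plane at `x i` carries mass more than `s`, the one at `a` exactly `s`.
  have hPa : ∀ x ∈ P, x i < a := by
    intro x hx
    by_contra hcon
    rw [not_lt] at hcon
    refine absurd (hP x hx) (not_lt.2 (le_trans ?_ ha.le))
    exact measureReal_mono (fun z hz => ⟨hz.1, hcon.trans hz.2⟩) (hfin _ Set.inter_subset_left)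
  set A' := A ∩ {z | a ≤ z i} with hA'
  have hA'm : MeasurableSet A' :=
    hA.inter (measurableSet_le measurable_const (measurable_pi_apply _))
  -- The cut set has mass `s ≥ 3tr²` and `G` removes at most `tr²` of it.
  have hrest : t * r ^ 2 / 200000 ≤ volume.real (A' \ G) := by
    have h1 : volume.real A' ≤ volume.real (A' \ G) + volume.real (G ∩ cube b (9 * r)) := by
      refine (measureReal_mono (fun z hz => ?_) ?_).trans (measureReal_union_le _ _)
      · by_cases hzG : z ∈ G
        · exact Or.inr ⟨hzG, hAb hz.1⟩
        · exact Or.inl ⟨hz, hzG⟩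
      · exact (measure_union_lt_top (hfin _ (Set.sdiff_subset.trans Set.inter_subset_left)).lt_top
          ((measure_mono Set.inter_subset_right).trans_lt (volume_cube_ne_top _ _).lt_top)).ne
    nlinarith
  obtain ⟨F, hFA, hFm, hFv⟩ := exists_subset_volume_eq (by positivity : (0 : ℝ) ≤ 9 * r)
    (hA'm.diff hG) (Set.sdiff_subset.trans (Set.inter_subset_left.trans hAb))
    (by positivity : 0 ≤ t * r ^ 2 / 200000) hrest
  refine ⟨F, fun z hz => ⟨(hFA hz).1.1, (hFA hz).2⟩, hFm, hFv.le, ?_⟩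
  have hfin2 : ∀ l, l = i ∨ l = j := by
    intro l; omega
  -- The square of side `10r` at `q` has its upper corner at `a` in direction `i` and at `b j + r`
  -- in direction `j`, exactly where `A'` may begin.
  set q : Fin 2 → ℝ := fun l => if l = i then a - 10 * r else b l - 9 * r with hq
  have hqi : q i = a - 10 * r := by simp [hq]
  have hqj : q j = b j - 9 * r := by simp [hq, hij.symm]
  have hx₀b := mem_cube.1 (hPb hx₀)
  have hsub : P ∪ {z | z ∈ cube (fun l => b l - r) r ∧ P.Nonempty} ⊆ cube q (10 * r) := by
    rintro z (hz | ⟨hz, -⟩)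
    · have h1 := mem_cube.1 (hPb hz)
      have h2 := hPa z hz
      refine mem_cube.2 fun l => ?_
      rcases hfin2 l with rfl | rfl
      · rw [hqi]
        constructor <;> linarith [(h1 l).1, (h1 l).2]
      · rw [hqj]
        constructor <;> linarith [(h1 l).1, (h1 l).2]
    · have h1 := mem_cube.1 hz
      have h2 := hPa x₀ hx₀
      refine mem_cube.2 fun l => ?_
      rcases hfin2 l with rfl | rfl
      · rw [hqi]
        constructor <;> linarith [(h1 l).1, (h1 l).2, (hx₀b l).1, (hx₀b l).2]
      · rw [hqj]
        constructor <;> linarith [(h1 l).1, (h1 l).2]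
  refine (weight_mono w hsub).trans (hK.weight_le hp (by positivity) hFm ?_ (by positivity) ?_)
  · intro z hz
    have hzA := (hFA hz).1
    have h1 := mem_cube.1 (hAb hzA.1)
    refine mem_cube.2 fun l => ?_
    rcases hfin2 l with rfl | rfl
    · simp only [hqi]
      constructor <;> linarith [(h1 l).1, (h1 l).2, show a ≤ z l from hzA.2]
    · simp only [hqj]
      constructor <;> linarith [(h1 l).1, (h1 l).2, hAj z hzA.1]
  -- Here `t / 20000000 * (10r)² = tr² / 200000`.
  · rw [hFv]
    linarith

/-- The points of `P` are sliced according to the mass to their right, in steps of `3tr²`. The two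
mass bounds leave the 107 slices `n = 2, …, 108`, and the sets found for the slices are united. -/
theorem exists_local_cover {p : ℝ} (hp : 1 ≤ p) {w v : (Fin 2 → ℝ) → ℝ≥0} {K : ℝ≥0}
    (hK : ApPlusRestrictedWith p w v K) {A : Set (Fin 2 → ℝ)} (hA : MeasurableSet A)
    {t r : ℝ} (ht : 0 < t) (hr : 0 < r) {i j : Fin 2} (hij : i ≠ j) (b : Fin 2 → ℝ)
    (hAb : A ⊆ cube b (9 * r)) (hAj : ∀ z ∈ A, b j + r ≤ z j)
    {G : Set (Fin 2 → ℝ)} (hG : MeasurableSet G)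
    (hGb : volume.real (G ∩ cube b (9 * r)) ≤ t * r ^ 2)
    {P : Set (Fin 2 → ℝ)} (hPb : P ⊆ cube b r) (hPne : P.Nonempty)
    (hlow : ∀ x ∈ P, 6 * (t * r ^ 2) ≤ volume.real (A ∩ {z | x i ≤ z i}))
    (hup : ∀ x ∈ P, volume.real (A ∩ {z | x i ≤ z i}) ≤ 324 * (t * r ^ 2)) :
    ∃ F ⊆ A \ G, MeasurableSet F ∧ volume.real F ≤ t * r ^ 2 / 1800 ∧
      weight w (P ∪ cube (fun l => b l - r) r) ≤
        107 * ((K : ℝ≥0∞) / ENNReal.ofReal (t / 20000000)) ^ p * weight v F := by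
  have htr : 0 < t * r ^ 2 := by positivity
  set f : (Fin 2 → ℝ) → ℕ := fun x =>
    ⌈volume.real (A ∩ {z | x i ≤ z i}) / (3 * (t * r ^ 2))⌉₊ with hf
  have hf2 : ∀ x ∈ P, f x ∈ Finset.Icc 2 108 := by
    intro x hx
    rw [Finset.mem_Icc]
    constructor
    · rw [hf, ← Nat.lt_iff_add_one_le, Nat.lt_ceil, lt_div_iff₀ (by positivity)]
      push_cast
      linarith [hlow x hx]
    · rw [hf, Nat.ceil_le, div_le_iff₀ (by positivity)]
      push_cast
      linarith [hup x hx]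
  have hpiece : ∀ n : ℕ, ∃ F ⊆ A \ G, MeasurableSet F ∧ volume.real F ≤ t * r ^ 2 / 200000 ∧
      (n ∈ Finset.Icc 2 108 →
      weight w ({x ∈ P | f x = n} ∪
          {z | z ∈ cube (fun l => b l - r) r ∧ {x ∈ P | f x = n}.Nonempty}) ≤
        ((K : ℝ≥0∞) / ENNReal.ofReal (t / 20000000)) ^ p * weight v F) := by
    intro n
    by_cases hn : n ∈ Finset.Icc 2 108
    · rw [Finset.mem_Icc] at hn
      have hn2 : (2 : ℝ) ≤ n := by exact_mod_cast hn.1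
      obtain ⟨F, h1, h2, h3, h4⟩ := exists_piece_cover hp hK hA ht hr hij b hAb hAj hG hGb
        (s := ((n : ℝ) - 1) * (3 * (t * r ^ 2))) (by nlinarith) (P := {x ∈ P | f x = n})
        (fun x hx => hPb hx.1) (by
          rintro x ⟨hx, hxn⟩
          rw [← lt_div_iff₀ (by positivity)]
          have : n - 1 < f x := by omega
          rw [hf, Nat.lt_ceil] at this
          rwa [Nat.cast_sub (by omega), Nat.cast_one] at this)
      exact ⟨F, h1, h2, h3, fun _ => h4⟩
    · exact ⟨∅, by simp, MeasurableSet.empty, by simp; positivity, fun h => absurd h hn⟩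
  choose F hFs hFm hFv hFw using hpiece
  refine ⟨⋃ n ∈ Finset.Icc 2 108, F n, by simpa using fun n _ _ => hFs n,
    Finset.measurableSet_biUnion _ fun n _ => hFm n, ?_, ?_⟩
  -- `107 / 200000 ≤ 1 / 1800`.
  · refine (measureReal_biUnion_finset_le _ _).trans
      ((Finset.sum_le_sum fun n _ => hFv n).trans ?_)
    rw [Finset.sum_const, Nat.card_Icc, nsmul_eq_mul]
    push_cast
    linarith
  · set D := ((K : ℝ≥0∞) / ENNReal.ofReal (t / 20000000)) ^ p with hD
    have hcov : P ∪ cube (fun l => b l - r) r ⊆ ⋃ n ∈ Finset.Icc 2 108, ({x ∈ P | f x = n} ∪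
          {z | z ∈ cube (fun l => b l - r) r ∧ {x ∈ P | f x = n}.Nonempty}) := by
      rintro z (hz | hz)
      · exact Set.mem_biUnion (hf2 z hz) (Or.inl ⟨hz, rfl⟩)
      · obtain ⟨x, hx⟩ := hPne
        exact Set.mem_biUnion (hf2 x hx) (Or.inr ⟨hz, x, hx, rfl⟩)
    calc _ ≤ _ := weight_mono w hcov
      _ ≤ ∑ n ∈ Finset.Icc 2 108, weight w ({x ∈ P | f x = n} ∪
          {z | z ∈ cube (fun l => b l - r) r ∧ {x ∈ P | f x = n}.Nonempty}) := by
        simp only [weight_eq]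
        exact measure_biUnion_finset_le _ _
      _ ≤ ∑ n ∈ Finset.Icc 2 108, D * weight v (⋃ n ∈ Finset.Icc 2 108, F n) :=
        Finset.sum_le_sum fun n hn => (hFw n hn).trans
          (mul_le_mul_right (weight_mono v (Set.subset_biUnion_of_mem (u := F) hn)) _)
      _ = _ := by
        rw [Finset.sum_const, Nat.card_Icc, nsmul_eq_mul, mul_assoc]
        norm_num

/-! ### Dyadic squares, shadows and Carleson packing -/

/-- The side length `2 ^ k` of the dyadic square with index `(k, m)`. -/
noncomputable def dyadicSide (B : ℤ × (Fin 2 → ℤ)) : ℝ := 2 ^ B.1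

/-- The lower-left corner `2 ^ k * m` of the dyadic square with index `(k, m)`. -/
noncomputable def dyadicCorner (B : ℤ × (Fin 2 → ℤ)) : Fin 2 → ℝ := fun l => B.2 l * dyadicSide B

/-- The dyadic square with index `(k, m)`. -/
def dyadicSquare (B : ℤ × (Fin 2 → ℤ)) : Set (Fin 2 → ℝ) := cube (dyadicCorner B) (dyadicSide B)

/-- The lower-left diagonal neighbour of a dyadic square. -/
def dyadicShadow (B : ℤ × (Fin 2 → ℤ)) : Set (Fin 2 → ℝ) :=
  cube (fun l => dyadicCorner B l - dyadicSide B) (dyadicSide B)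

/-- The lower-left quarter of the diagonal neighbour of a dyadic square. -/
def dyadicCore (B : ℤ × (Fin 2 → ℤ)) : Set (Fin 2 → ℝ) :=
  cube (fun l => dyadicCorner B l - dyadicSide B) (dyadicSide B / 2)

theorem dyadicSide_pos (B : ℤ × (Fin 2 → ℤ)) : 0 < dyadicSide B := by
  unfold dyadicSide; positivity

theorem dyadicSide_le {B B' : ℤ × (Fin 2 → ℤ)} (h : B'.1 ≤ B.1) :
    dyadicSide B' ≤ dyadicSide B :=
  zpow_le_zpow_right₀ one_le_two h

theorem dyadicSide_eq_mul {B B' : ℤ × (Fin 2 → ℤ)} (h : B'.1 < B.1) :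
    ∃ d : ℤ, 2 ≤ d ∧ dyadicSide B = d * dyadicSide B' := by
  refine ⟨2 ^ (B.1 - B'.1).toNat, ?_, ?_⟩
  · exact le_self_pow₀ one_le_two (by omega)
  · unfold dyadicSide
    push_cast
    rw [← zpow_natCast, ← zpow_add₀ two_ne_zero]
    congr 1
    omega

theorem measurableSet_dyadicCore (B : ℤ × (Fin 2 → ℤ)) : MeasurableSet (dyadicCore B) :=
  measurableSet_cube _ _

/-- The cores of two dyadic squares are disjoint unless the smaller square lies in the
shadow of the larger one. -/
theorem disjoint_dyadicCore {B B' : ℤ × (Fin 2 → ℤ)} (hne : B' ≠ B) (hle : B'.1 ≤ B.1)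
    (hsub : B'.1 < B.1 → ¬ dyadicSquare B' ⊆ dyadicShadow B) :
    Disjoint (dyadicCore B') (dyadicCore B) := by
  rw [Set.disjoint_left]
  intro z hz' hz
  have hz' := mem_cube.1 hz'
  have hz := mem_cube.1 hz
  have hr' := dyadicSide_pos B'
  have hr := dyadicSide_pos B
  rcases hle.lt_or_eq with hlt | heq
  · obtain ⟨d, hd, hdr⟩ := dyadicSide_eq_mul hlt
    have hd' : (2 : ℝ) ≤ d := by exact_mod_cast hd
    refine hsub hlt fun y hy => mem_cube.2 fun l => ?_
    have hy := mem_cube.1 hy l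
    have hzl := hz l
    have hzl' := hz' l
    -- The core stays half a side below the corner of `B`, and the smaller side is at most that
    -- half. So the corner of `B'` lies strictly below that of `B`; both are on the finer grid,
    -- which gains a full step.
    have hup : dyadicCorner B' l + dyadicSide B' ≤ dyadicCorner B l := by
      simp only [dyadicCorner] at hzl hzl' ⊢
      rw [hdr] at hzl ⊢
      have h1 : (B'.2 l : ℝ) * dyadicSide B' < (B.2 l * d : ℝ) * dyadicSide B' := by nlinarith
      have h2 : B'.2 l < B.2 l * d := by exact_mod_cast lt_of_mul_lt_mul_right h1 hr'.le
      have h3 : (B'.2 l : ℝ) + 1 ≤ B.2 l * d := by exact_mod_cast h2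
      nlinarith
    constructor <;> linarith [hzl.1, hzl'.2, hy.1, hy.2]
  · apply hne
    have hs : dyadicSide B' = dyadicSide B := by simp [dyadicSide, heq]
    refine Prod.ext heq (funext fun l => ?_)
    have hzl := hz l
    have hzl' := hz' l
    simp only [dyadicCorner, hs] at hzl hzl'
    have h1 : (B'.2 l : ℝ) < B.2 l + 1 := by
      refine lt_of_mul_lt_mul_right (a := dyadicSide B) ?_ hr.le
      linarith [hzl.1, hzl'.2]
    have h2 : (B.2 l : ℝ) < B'.2 l + 1 := by
      refine lt_of_mul_lt_mul_right (a := dyadicSide B) ?_ hr.le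
      linarith [hzl.1, hzl'.2]
    have h1 : B'.2 l < B.2 l + 1 := by exact_mod_cast h1
    have h2 : B.2 l < B'.2 l + 1 := by exact_mod_cast h2
    omega

/-- No square of the family lies in the shadow of a larger square of the family. -/
def ShadowFree (S : Finset (ℤ × (Fin 2 → ℤ))) : Prop :=
  ∀ B ∈ S, ∀ B' ∈ S, B'.1 < B.1 → ¬ dyadicSquare B' ⊆ dyadicShadow B

theorem exists_shadowFree (T : Finset (ℤ × (Fin 2 → ℤ))) :
    ∃ S ⊆ T, ShadowFree S ∧ ∀ B ∈ T, B ∈ S ∨ ∃ B' ∈ S, dyadicSquare B ⊆ dyadicShadow B' := by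
  classical
  -- Greedy selection from large to small: the new square has minimal side, so it cannot shadow a
  -- strictly larger one chosen before.
  induction T using Finset.induction_on_min_value (fun B : ℤ × (Fin 2 → ℤ) => B.1) with
  | empty => exact ⟨∅, subset_rfl, by simp [ShadowFree], by simp⟩
  | insert B T _ hmin ih =>
    obtain ⟨S, hST, hS, hcov⟩ := ih
    by_cases hB : ∃ B' ∈ S, dyadicSquare B ⊆ dyadicShadow B'
    · refine ⟨S, hST.trans (Finset.subset_insert _ _), hS, fun A hA => ?_⟩
      rcases Finset.mem_insert.1 hA with rfl | hA
      · exact Or.inr hB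
      · exact hcov A hA
    · push Not at hB
      refine ⟨insert B S, Finset.insert_subset_insert _ hST, ?_, fun A hA => ?_⟩
      · intro A hA A' hA' hlt
        rcases Finset.mem_insert.1 hA with rfl | hAS
        · rcases Finset.mem_insert.1 hA' with rfl | hAS'
          · exact absurd hlt (lt_irrefl _)
          · exact absurd hlt (not_lt.2 (hmin _ (hST hAS')))
        · rcases Finset.mem_insert.1 hA' with rfl | hAS'
          · exact hB A hAS
          · exact hS A hAS A' hAS' hlt
      · rcases Finset.mem_insert.1 hA with rfl | hA
        · exact Or.inl (Finset.mem_insert_self _ _)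
        · rcases hcov A hA with h | ⟨A', hA', h⟩
          · exact Or.inl (Finset.mem_insert_of_mem h)
          · exact Or.inr ⟨A', Finset.mem_insert_of_mem hA', h⟩

/-- Carleson packing for a shadow-free family. -/
theorem ShadowFree.sum_sq_le {S : Finset (ℤ × (Fin 2 → ℤ))} (hS : ShadowFree S)
    (B : ℤ × (Fin 2 → ℤ)) (hle : ∀ B' ∈ S, B'.1 ≤ B.1)
    (hnear : ∀ B' ∈ S, (cube (dyadicCorner B') (9 * dyadicSide B') ∩
      cube (dyadicCorner B) (9 * dyadicSide B)).Nonempty) :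
    ∑ B' ∈ S, dyadicSide B' ^ 2 ≤ 1444 * dyadicSide B ^ 2 := by
  have hr := dyadicSide_pos B
  have hdisj : (S : Set (ℤ × (Fin 2 → ℤ))).PairwiseDisjoint dyadicCore := by
    intro C hC C' hC' hne
    rcases le_total C.1 C'.1 with h | h
    · exact disjoint_dyadicCore hne h (hS C' hC' C hC)
    · exact (disjoint_dyadicCore hne.symm h (hS C hC C' hC')).symm
  have hsub : (⋃ B' ∈ S, dyadicCore B') ⊆
      cube (fun l => dyadicCorner B l - 10 * dyadicSide B) (19 * dyadicSide B) := by
    refine Set.iUnion₂_subset fun B' hB' z hz => mem_cube.2 fun l => ?_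
    obtain ⟨y, hy', hy⟩ := hnear B' hB'
    have h1 := mem_cube.1 hz l
    have h2 := mem_cube.1 hy' l
    have h3 := mem_cube.1 hy l
    have h4 := dyadicSide_le (hle B' hB')
    have h5 := dyadicSide_pos B'
    constructor <;> linarith [h1.1, h1.2, h2.1, h2.2, h3.1, h3.2]
  -- Disjoint cores of area `dyadicSide B' ^ 2 / 4` in a square of side `19r` give `4 * 19² = 1444`.
  have h := measureReal_mono (μ := volume) hsub (volume_cube_ne_top _ _)
  rw [measureReal_biUnion_finset hdisj (fun B' _ => measurableSet_dyadicCore B')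
    (fun _ _ => volume_cube_ne_top _ _), volume_real_cube _ (by positivity)] at h
  have h' : ∀ B' ∈ S, volume.real (dyadicCore B') = dyadicSide B' ^ 2 / 4 := by
    intro B' _
    rw [dyadicCore, volume_real_cube _ (half_pos (dyadicSide_pos B')).le]
    ring
  rw [Finset.sum_congr rfl h', ← Finset.sum_div] at h
  linarith

/-! ### Disjoint choice and summation over dyadic squares -/

/-- Given a shadow-free family and an assignment of sets that can be made locally after the
removal of a small set, the sets can be chosen pairwise disjoint. -/
theorem exists_disjoint_assignment {t : ℝ} (ht : 0 < t) {E : Set (Fin 2 → ℝ)}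
    {S : Finset (ℤ × (Fin 2 → ℤ))} (hS : ShadowFree S)
    {R : (ℤ × (Fin 2 → ℤ)) → Set (Fin 2 → ℝ) → Prop}
    (hR : ∀ B ∈ S, ∀ G, MeasurableSet G →
      volume.real (G ∩ cube (dyadicCorner B) (9 * dyadicSide B)) ≤ t * dyadicSide B ^ 2 →
      ∃ F ⊆ (E ∩ cube (dyadicCorner B) (9 * dyadicSide B)) \ G, MeasurableSet F ∧
        volume.real F ≤ t * dyadicSide B ^ 2 / 1800 ∧ R B F) :
    ∃ e : (ℤ × (Fin 2 → ℤ)) → Set (Fin 2 → ℝ),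
      (S : Set (ℤ × (Fin 2 → ℤ))).PairwiseDisjoint e ∧
      ∀ B ∈ S, e B ⊆ E ∩ cube (dyadicCorner B) (9 * dyadicSide B) ∧ MeasurableSet (e B) ∧
        volume.real (e B) ≤ t * dyadicSide B ^ 2 / 1800 ∧ R B (e B) := by
  classical
  -- From small to large, so that the packing bound applies to the squares already treated. They
  -- occupy at most `1444 / 1800` of the allowed `tr²` near `B`.
  induction S using Finset.induction_on_max_value (fun B : ℤ × (Fin 2 → ℤ) => B.1) with
  | empty => exact ⟨fun _ => ∅, by simp, by simp⟩
  | insert B S hBS hmax ih =>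
    obtain ⟨e, hdisj, he⟩ := ih
      (fun A hA A' hA' => hS A (Finset.mem_insert_of_mem hA) A' (Finset.mem_insert_of_mem hA'))
      (fun A hA => hR A (Finset.mem_insert_of_mem hA))
    set N : Finset (ℤ × (Fin 2 → ℤ)) := S.filter fun B' =>
      (cube (dyadicCorner B') (9 * dyadicSide B') ∩
        cube (dyadicCorner B) (9 * dyadicSide B)).Nonempty with hN
    have hNS : N ⊆ S := Finset.filter_subset _ _
    have hsum : ∑ B' ∈ N, dyadicSide B' ^ 2 ≤ 1444 * dyadicSide B ^ 2 :=
      ShadowFree.sum_sq_le (fun A hA A' hA' => hS A (Finset.mem_insert_of_mem (hNS hA)) A'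
        (Finset.mem_insert_of_mem (hNS hA'))) B (fun B' h => hmax B' (hNS h))
        (fun B' h => (Finset.mem_filter.1 h).2)
    have hsmall : volume.real ((⋃ B' ∈ S, e B') ∩ cube (dyadicCorner B) (9 * dyadicSide B)) ≤
        t * dyadicSide B ^ 2 := by
      have hsub : (⋃ B' ∈ S, e B') ∩ cube (dyadicCorner B) (9 * dyadicSide B) ⊆
          ⋃ B' ∈ N, e B' := by
        rintro z ⟨hz, hzB⟩
        simp only [Set.mem_iUnion] at hz ⊢
        obtain ⟨B', hB', hzB'⟩ := hz
        exact ⟨B', Finset.mem_filter.2 ⟨hB', z, ((he B' hB').1 hzB').2, hzB⟩, hzB'⟩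
      have hfin : volume (⋃ B' ∈ N, e B') ≠ ∞ := by
        refine ((measure_biUnion_finset_le _ _).trans_lt (ENNReal.sum_lt_top.2 fun B' hB' => ?_)).ne
        exact (measure_mono ((he B' (hNS hB')).1.trans Set.inter_subset_right)).trans_lt
          (volume_cube_ne_top _ _).lt_top
      calc _ ≤ _ := measureReal_mono hsub hfin
        _ ≤ ∑ B' ∈ N, volume.real (e B') := measureReal_biUnion_finset_le _ _
        _ ≤ ∑ B' ∈ N, t * dyadicSide B' ^ 2 / 1800 :=
          Finset.sum_le_sum fun B' hB' => (he B' (hNS hB')).2.2.1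
        _ = t / 1800 * ∑ B' ∈ N, dyadicSide B' ^ 2 := by
          rw [Finset.mul_sum]
          exact Finset.sum_congr rfl fun _ _ => by ring
        _ ≤ t / 1800 * (1444 * dyadicSide B ^ 2) := by gcongr
        _ ≤ t * dyadicSide B ^ 2 := by
          have : 0 < t * dyadicSide B ^ 2 := mul_pos ht (pow_pos (dyadicSide_pos B) 2)
          linarith
    obtain ⟨F, hFs, hFm, hFv, hFR⟩ := hR B (Finset.mem_insert_self _ _) _
      (Finset.measurableSet_biUnion S fun B' hB' => (he B' hB').2.1) hsmall
    have hne : ∀ B' ∈ S, B' ≠ B := fun B' hB' h => hBS (h ▸ hB')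
    refine ⟨Function.update e B F, ?_, fun A hA => ?_⟩
    · have hF : ∀ B' ∈ S, Disjoint (e B') F := fun B' hB' =>
        Set.disjoint_left.2 fun z hz hzF => (hFs hzF).2 (Set.mem_biUnion hB' hz)
      intro A hA A' hA' hAA'
      rcases Finset.mem_insert.1 hA with rfl | hAS
      · rcases Finset.mem_insert.1 hA' with rfl | hAS'
        · exact absurd rfl hAA'
        · simpa [Function.onFun, Function.update_of_ne (hne _ hAS')] using (hF _ hAS').symm
      · rcases Finset.mem_insert.1 hA' with rfl | hAS'
        · simpa [Function.onFun, Function.update_of_ne (hne _ hAS)] using hF _ hAS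
        · simpa [Function.onFun, Function.update_of_ne (hne _ hAS),
            Function.update_of_ne (hne _ hAS')] using hdisj hAS hAS' hAA'
    · rcases Finset.mem_insert.1 hA with rfl | hA
      · simpa using ⟨by simpa using hFs.trans Set.sdiff_subset, hFm, hFv, hFR⟩
      · simpa [Function.update_of_ne (hne _ hA)] using he A hA

/-- The part of `E` in the nine-fold enlargement of a dyadic square, strictly above the square in
the `j`-th direction. -/
def upperPart (E : Set (Fin 2 → ℝ)) (j : Fin 2) (B : ℤ × (Fin 2 → ℤ)) : Set (Fin 2 → ℝ) :=
  (E ∩ cube (dyadicCorner B) (9 * dyadicSide B)) ∩ {z | dyadicCorner B j + dyadicSide B ≤ z j}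

/-- The points of a dyadic square to the right of which, in the `i`-th direction, `E` has mass
comparable to `t r ^ 2` above the square. -/
def levelPart (E : Set (Fin 2 → ℝ)) (t : ℝ) (i j : Fin 2) (B : ℤ × (Fin 2 → ℤ)) :
    Set (Fin 2 → ℝ) :=
  {x ∈ dyadicSquare B |
    6 * (t * dyadicSide B ^ 2) ≤ volume.real (upperPart E j B ∩ {z | x i ≤ z i}) ∧
    volume.real (upperPart E j B ∩ {z | x i ≤ z i}) ≤ 324 * (t * dyadicSide B ^ 2)}

theorem weight_biUnion_levelPart_le {p : ℝ} (hp : 1 ≤ p) {w v : (Fin 2 → ℝ) → ℝ≥0} {K : ℝ≥0}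
    (hK : ApPlusRestrictedWith p w v K) {E : Set (Fin 2 → ℝ)} (hE : MeasurableSet E)
    {t : ℝ} (ht : 0 < t) {i j : Fin 2} (hij : i ≠ j) (T : Finset (ℤ × (Fin 2 → ℤ))) :
    weight w (⋃ B ∈ T, levelPart E t i j B) ≤
      107 * ((K : ℝ≥0∞) / ENNReal.ofReal (t / 20000000)) ^ p * weight v E := by
  classical
  set D := 107 * ((K : ℝ≥0∞) / ENNReal.ofReal (t / 20000000)) ^ p with hD
  -- Squares with empty level part are removed first, because the shadow of a selected square is
  -- controlled only if its level part is nonempty.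
  obtain ⟨S, hST, hS, hcov⟩ := exists_shadowFree (T.filter fun B => (levelPart E t i j B).Nonempty)
  obtain ⟨e, hdisj, he⟩ := exists_disjoint_assignment (E := E) ht hS
    (R := fun B F => weight w (levelPart E t i j B ∪ dyadicShadow B) ≤ D * weight v F) (by
      intro B hB G hG hGB
      obtain ⟨F, h1, h2⟩ := exists_local_cover hp hK (A := upperPart E j B)
        ((hE.inter (measurableSet_cube _ _)).inter
          (measurableSet_le measurable_const (measurable_pi_apply _)))
        ht (dyadicSide_pos B) hij (dyadicCorner B) (fun z hz => hz.1.2) (fun z hz => hz.2) hG hGB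
        (P := levelPart E t i j B) (fun x hx => hx.1) (Finset.mem_filter.1 (hST hB)).2
        (fun x hx => hx.2.1) (fun x hx => hx.2.2)
      exact ⟨F, h1.trans (Set.sdiff_subset_sdiff_left Set.inter_subset_left), h2⟩)
  have hsub : (⋃ B ∈ T, levelPart E t i j B) ⊆
      ⋃ B ∈ S, (levelPart E t i j B ∪ dyadicShadow B) := by
    refine Set.iUnion₂_subset fun B hB x hx => ?_
    rcases hcov B (Finset.mem_filter.2 ⟨hB, x, hx⟩) with h | ⟨B', hB', h⟩
    · exact Set.mem_biUnion h (Or.inl hx)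
    · exact Set.mem_biUnion hB' (Or.inr (h hx.1))
  calc _ ≤ _ := weight_mono w hsub
    _ ≤ ∑ B ∈ S, weight w (levelPart E t i j B ∪ dyadicShadow B) := by
      simp only [weight_eq]
      exact measure_biUnion_finset_le _ _
    _ ≤ ∑ B ∈ S, D * weight v (e B) := Finset.sum_le_sum fun B hB => (he B hB).2.2.2
    _ = D * weight v (⋃ B ∈ S, e B) := by
      rw [← Finset.mul_sum]
      simp only [weight_eq]
      rw [measure_biUnion_finset hdisj fun B hB => (he B hB).2.1]
    _ ≤ D * weight v E := by
      gcongr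
      exact weight_mono v (Set.iUnion₂_subset fun B hB => (he B hB).1.trans Set.inter_subset_left)

theorem weight_iUnion_levelPart_le {p : ℝ} (hp : 1 ≤ p) {w v : (Fin 2 → ℝ) → ℝ≥0} {K : ℝ≥0}
    (hK : ApPlusRestrictedWith p w v K) {E : Set (Fin 2 → ℝ)} (hE : MeasurableSet E)
    {t : ℝ} (ht : 0 < t) {i j : Fin 2} (hij : i ≠ j) :
    weight w (⋃ B, levelPart E t i j B) ≤
      107 * ((K : ℝ≥0∞) / ENNReal.ofReal (t / 20000000)) ^ p * weight v E := by
  rw [Set.iUnion_eq_iUnion_finset, weight_eq, Directed.measure_iUnion]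
  · refine iSup_le fun T => ?_
    rw [← weight_eq]
    exact weight_biUnion_levelPart_le hp hK hE ht hij T
  · exact directed_of_isDirected_le fun S T hST => Set.biUnion_subset_biUnion_left hST

/-! ### From the maximal function to level parts -/

theorem maximalPlus_indicator {E : Set (Fin 2 → ℝ)} (hE : NullMeasurableSet E volume)
    (x : Fin 2 → ℝ) :
    maximalPlus (E.indicator 1) x =
      ⨆ (h : ℝ) (_ : 0 < h), (volume (cube x h))⁻¹ * volume (E ∩ cube x h) := by
  unfold maximalPlus
  refine iSup_congr fun h => iSup_congr fun _ => ?_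
  congr 1
  have : (fun y => ‖E.indicator (1 : (Fin 2 → ℝ) → ℝ) y‖ₑ) = E.indicator 1 := by
    ext y
    by_cases hy : y ∈ E <;> simp [hy]
  rw [this, lintegral_indicator_one₀ (hE.mono_ac
    (Measure.absolutelyContinuous_of_le Measure.restrict_le_self)), Measure.restrict_apply₀' (measurableSet_cube x h).nullMeasurableSet]

theorem maximalPlus_indicator_le_one {E : Set (Fin 2 → ℝ)} (hE : NullMeasurableSet E volume)
    (x : Fin 2 → ℝ) : maximalPlus (E.indicator 1) x ≤ 1 := by
  rw [maximalPlus_indicator hE]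
  refine iSup₂_le fun h _ => ?_
  rw [mul_comm, ← div_eq_mul_inv]
  exact ENNReal.div_le_of_le_mul (by simpa using measure_mono Set.inter_subset_right)

theorem exists_mem_dyadicSquare (x : Fin 2 → ℝ) (k : ℤ) :
    ∃ B : ℤ × (Fin 2 → ℤ), B.1 = k ∧ x ∈ dyadicSquare B := by
  refine ⟨(k, fun l => ⌊x l / 2 ^ k⌋), rfl, mem_cube.2 fun l => ?_⟩
  have hr : (0 : ℝ) < 2 ^ k := by positivity
  simp only [dyadicCorner, dyadicSide]
  constructor
  · rw [← le_div_iff₀ hr]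
    exact Int.floor_le _
  · have := Int.lt_floor_add_one (x l / 2 ^ k)
    rw [div_lt_iff₀ hr] at this
    linarith

theorem average_le_iff {E : Set (Fin 2 → ℝ)} {x : Fin 2 → ℝ} {h : ℝ} (hh : 0 < h) (t : ℝ≥0) :
    (volume (cube x h))⁻¹ * volume (E ∩ cube x h) ≤ t ↔
      volume.real (E ∩ cube x h) ≤ t * h ^ 2 := by
  have hne : volume (E ∩ cube x h) ≠ ∞ :=
    ne_top_of_le_ne_top (volume_cube_ne_top x h) (measure_mono Set.inter_subset_right)
  have hv : volume (cube x h) = ENNReal.ofReal (h ^ 2) := by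
    rw [volume_cube, ENNReal.ofReal_pow hh.le]
  rw [mul_comm, ← div_eq_mul_inv, hv, ENNReal.div_le_iff (by simp [hh.ne']) ENNReal.ofReal_ne_top,
    ← ENNReal.ofReal_coe_nnreal, ← ENNReal.ofReal_mul t.coe_nonneg, Measure.real,
    ENNReal.le_ofReal_iff_toReal_le hne (by positivity)]

theorem setOf_maximalPlus_subset {E : Set (Fin 2 → ℝ)} (hE : MeasurableSet E) (t : ℝ≥0) :
    {x | (t : ℝ≥0∞) < maximalPlus (E.indicator 1) x ∧
      maximalPlus (E.indicator 1) x ≤ (4 * t : ℝ≥0)} ⊆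
      (⋃ B, levelPart E t 0 1 B) ∪ ⋃ B, levelPart E t 1 0 B := by
  rintro x ⟨hlt, hle⟩
  rw [maximalPlus_indicator hE.nullMeasurableSet] at hlt hle
  simp only [lt_iSup_iff] at hlt
  obtain ⟨h, hh, hlt⟩ := hlt
  rw [← not_le, average_le_iff hh, not_le] at hlt
  have hup : ∀ H, 0 < H → volume.real (E ∩ cube x H) ≤ 4 * t * H ^ 2 := by
    intro H hH
    have := (average_le_iff (E := E) hH (4 * t)).1 ((le_iSup₂ (f := fun (h : ℝ) (_ : 0 < h) =>
      (volume (cube x h))⁻¹ * volume (E ∩ cube x h)) H hH).trans hle)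
    simpa using this
  -- The scale `r = 2 ^ k` satisfies `4r ≤ h < 8r`: the square `Q_{x,h}` fits in the nine-fold
  -- enlargement of `B`, and a shift by `h/4` from `x` clears `B`.
  obtain ⟨k, hk1, hk2⟩ := exists_mem_Ico_zpow (div_pos hh four_pos) one_lt_two
  obtain ⟨B, hBk, hxB⟩ := exists_mem_dyadicSquare x k
  have hr := dyadicSide_pos B
  have hrk : dyadicSide B = 2 ^ k := by rw [dyadicSide, hBk]
  rw [zpow_add_one₀ two_ne_zero] at hk2
  rw [← hrk] at hk1 hk2
  have hxB' := mem_cube.1 hxB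
  have hfin : ∀ j, volume (E ∩ {z ∈ cube x h | x j + h / 4 ≤ z j}) ≠ ∞ := fun j =>
    ne_top_of_le_ne_top (volume_cube_ne_top x h) (measure_mono fun z hz => hz.2.1)
  have hmem : ∀ i j : Fin 2, i ≠ j →
      3 / 8 * (t * h ^ 2) ≤ volume.real (E ∩ {z ∈ cube x h | x j + h / 4 ≤ z j}) →
      x ∈ levelPart E t i j B := by
    intro i j hij hmass
    refine ⟨hxB, ?_, ?_⟩
    · have h1 : 6 * (t * dyadicSide B ^ 2) ≤ 3 / 8 * (t * h ^ 2) := by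
        have : (4 * dyadicSide B) ^ 2 ≤ h ^ 2 := by gcongr; linarith
        nlinarith [t.2]
      refine (h1.trans hmass).trans (measureReal_mono ?_ ?_)
      · rintro z ⟨hzE, hz, hzj⟩
        have hz := mem_cube.1 hz
        refine ⟨⟨⟨hzE, mem_cube.2 fun l => ?_⟩, ?_⟩, (hz i).1⟩
        · constructor <;> linarith [(hz l).1, (hz l).2, (hxB' l).1, (hxB' l).2]
        · show dyadicCorner B j + dyadicSide B ≤ z j
          linarith [(hxB' j).1]
      · exact ne_top_of_le_ne_top (volume_cube_ne_top (dyadicCorner B) (9 * dyadicSide B))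
          (measure_mono fun z hz => hz.1.1.2)
    -- The constant is `324 = 4 * 9²`.
    · have h1 := hup (9 * dyadicSide B) (by positivity)
      have h2 : volume.real (upperPart E j B ∩ {z | x i ≤ z i}) ≤
          volume.real (E ∩ cube x (9 * dyadicSide B)) := by
        refine measureReal_mono ?_ (ne_top_of_le_ne_top (volume_cube_ne_top x (9 * dyadicSide B))
          (measure_mono Set.inter_subset_right))
        rintro z ⟨⟨⟨hzE, hz⟩, hzj⟩, hzi⟩
        have hz := mem_cube.1 hz
        refine ⟨hzE, mem_cube.2 fun l => ?_⟩
        have hl : l = i ∨ l = j := by omega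
        rcases hl with rfl | rfl
        · exact ⟨hzi, by linarith [(hz l).2, (hxB' l).1]⟩
        · exact ⟨by linarith [(hxB' l).2, show dyadicCorner B l + dyadicSide B ≤ z l from hzj],
            by linarith [(hz l).2, (hxB' l).1]⟩
      linarith
  have hsplit : volume.real (E ∩ cube x h) ≤ volume.real (E ∩ cube x (h / 4)) +
      volume.real (E ∩ {z ∈ cube x h | x 0 + h / 4 ≤ z 0}) +
      volume.real (E ∩ {z ∈ cube x h | x 1 + h / 4 ≤ z 1}) := by
    have hfin' : volume (E ∩ cube x (h / 4)) ≠ ∞ :=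
      ne_top_of_le_ne_top (volume_cube_ne_top x _) (measure_mono Set.inter_subset_right)
    refine le_trans (measureReal_mono ?_ ?_) ((measureReal_union_le _ _).trans
      (add_le_add_left (measureReal_union_le _ _) _))
    · rintro z ⟨hzE, hz⟩
      by_cases h0 : x 0 + h / 4 ≤ z 0
      · exact Or.inl (Or.inr ⟨hzE, hz, h0⟩)
      by_cases h1 : x 1 + h / 4 ≤ z 1
      · exact Or.inr ⟨hzE, hz, h1⟩
      refine Or.inl (Or.inl ⟨hzE, mem_cube.2 fun l => ⟨(mem_cube.1 hz l).1, ?_⟩⟩)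
      fin_cases l
      · exact not_le.1 h0
      · exact not_le.1 h1
    · exact (measure_union_lt_top (measure_union_lt_top hfin'.lt_top (hfin 0).lt_top)
        (hfin 1).lt_top).ne
  -- The small square has mass at most `t h² / 4`, so the two strips share at least `3/4 * t h²` and
  -- one of them has half of that.
  have hquarter := hup (h / 4) (by positivity)
  by_cases h0 : 3 / 8 * (t * h ^ 2) ≤ volume.real (E ∩ {z ∈ cube x h | x 0 + h / 4 ≤ z 0})
  · exact Or.inr (Set.mem_iUnion.2 ⟨B, hmem 1 0 (by decide) h0⟩)
  · refine Or.inl (Set.mem_iUnion.2 ⟨B, hmem 0 1 (by decide) ?_⟩)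
    linarith

theorem weight_between_levels_le {p : ℝ} (hp : 1 ≤ p) {w v : (Fin 2 → ℝ) → ℝ≥0} {K : ℝ≥0}
    (hK : ApPlusRestrictedWith p w v K) {E : Set (Fin 2 → ℝ)} (hE : MeasurableSet E)
    {t : ℝ≥0} (ht : 0 < t) :
    weight w {x | (t : ℝ≥0∞) < maximalPlus (E.indicator 1) x ∧
      maximalPlus (E.indicator 1) x ≤ (4 * t : ℝ≥0)} ≤
      214 * ((K * 20000000 : ℝ≥0∞) / t) ^ p * weight v E := by
  have hD : (K : ℝ≥0∞) / ENNReal.ofReal ((t : ℝ) / 20000000) = (K * 20000000 : ℝ≥0∞) / t := by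
    rw [ENNReal.ofReal_div_of_pos (by norm_num), ENNReal.ofReal_coe_nnreal,
      ENNReal.ofReal_ofNat, div_eq_mul_inv, ENNReal.inv_div (by simp) (by simp), mul_div_assoc]
  have ht' : (0 : ℝ) < t := by exact_mod_cast ht
  calc _ ≤ _ := weight_mono w (setOf_maximalPlus_subset hE t)
    _ ≤ weight w (⋃ B, levelPart E t 0 1 B) + weight w (⋃ B, levelPart E t 1 0 B) := by
      simp only [weight_eq]
      exact measure_union_le _ _
    _ ≤ _ := add_le_add (weight_iUnion_levelPart_le hp hK hE ht' (by decide))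
        (weight_iUnion_levelPart_le hp hK hE ht' (by decide))
    _ = _ := by rw [hD]; ring

/-! ### Summation over the levels -/

/-- The weak type constant for exponent `p`. -/
noncomputable def weakTypeConst (p : ℝ) : ℝ≥0 := 428 * 20000000 ^ p

theorem weakTypeConst_pos (p : ℝ) : 0 < weakTypeConst p :=
  mul_pos (by norm_num) (NNReal.rpow_pos (by norm_num))

theorem exists_level {t M : ℝ≥0∞} (ht : t ≠ 0) (htM : t < M) (hM : M ≤ 1) :
    ∃ l : ℕ, 4 ^ l * t < M ∧ M ≤ 4 * (4 ^ l * t) := by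
  have hex : ∃ l : ℕ, M ≤ 4 ^ l * t := by
    have h4 : Filter.Tendsto (fun l : ℕ => (4 : ℝ≥0∞) ^ l * t) Filter.atTop (nhds ∞) := by
      have := ENNReal.Tendsto.mul_const (b := t)
        (ENNReal.tendsto_pow_atTop_nhds_top_iff.2 (by norm_num : (1 : ℝ≥0∞) < 4))
        (Or.inl ENNReal.top_ne_zero)
      rwa [ENNReal.top_mul ht] at this
    obtain ⟨l, hl⟩ := (h4.eventually (lt_mem_nhds ENNReal.one_lt_top)).exists
    exact ⟨l, hM.trans hl.le⟩
  classical
  have hpos : Nat.find hex ≠ 0 := by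
    intro h0
    have := Nat.find_spec hex
    rw [h0] at this
    simp at this
    exact absurd htM (not_lt.2 this)
  obtain ⟨l, hl⟩ := Nat.exists_eq_succ_of_ne_zero hpos
  refine ⟨l, not_le.1 (Nat.find_min hex (by omega)), ?_⟩
  have := Nat.find_spec hex
  rw [hl, Nat.succ_eq_add_one, pow_succ'] at this
  rwa [← mul_assoc]

theorem ApPlusRestrictedWith.weight_maximalPlus_le {p : ℝ} (hp : 1 ≤ p)
    {w v : (Fin 2 → ℝ) → ℝ≥0} {K : ℝ≥0}
    (hK : ApPlusRestrictedWith p w v K) {E : Set (Fin 2 → ℝ)} (hE : MeasurableSet E)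
    {t : ℝ≥0} (ht : 0 < t) :
    weight w {x | (t : ℝ≥0∞) < maximalPlus (E.indicator 1) x} ≤
      weakTypeConst p * (K : ℝ≥0∞) ^ p / (t : ℝ≥0∞) ^ p * weight v E := by
  have hp0 : 0 ≤ p := by linarith
  have ht0 : (t : ℝ≥0∞) ≠ 0 := by exact_mod_cast ht.ne'
  set S : ℕ → Set (Fin 2 → ℝ) := fun l =>
    {x | ((4 ^ l * t : ℝ≥0) : ℝ≥0∞) < maximalPlus (E.indicator 1) x ∧
      maximalPlus (E.indicator 1) x ≤ (4 * (4 ^ l * t) : ℝ≥0)} with hS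
  have hsub : {x | (t : ℝ≥0∞) < maximalPlus (E.indicator 1) x} ⊆ ⋃ l, S l := by
    intro x hx
    obtain ⟨l, h1, h2⟩ := exists_level ht0 hx (maximalPlus_indicator_le_one hE.nullMeasurableSet x)
    exact Set.mem_iUnion.2 ⟨l, by push_cast; exact h1, by push_cast; exact h2⟩
  have hlevel : ∀ l, weight w (S l) ≤
      (2⁻¹ : ℝ≥0∞) ^ l * (214 * ((K * 20000000 : ℝ≥0∞) / t) ^ p * weight v E) := by
    intro l
    refine (weight_between_levels_le hp hK hE (by positivity)).trans ?_
    have h1 : (K * 20000000 : ℝ≥0∞) / ((4 ^ l * t : ℝ≥0) : ℝ≥0∞) =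
        (4 ^ l)⁻¹ * ((K * 20000000 : ℝ≥0∞) / t) := by
      push_cast
      rw [div_eq_mul_inv, ENNReal.mul_inv (Or.inl (by simp)) (Or.inl (by simp)), div_eq_mul_inv]
      ring
    -- Since `p ≥ 1`, the decay is at least `4^{-l}`; it is weakened to `2^{-l}`, whose sum is 2,
    -- whence `428 = 2 * 214`.
    have h2 : (((4 : ℝ≥0∞) ^ l)⁻¹) ^ p ≤ (2⁻¹ : ℝ≥0∞) ^ l := by
      calc (((4 : ℝ≥0∞) ^ l)⁻¹) ^ p ≤ (((4 : ℝ≥0∞) ^ l)⁻¹) ^ (1 : ℝ) :=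
            ENNReal.rpow_le_rpow_of_exponent_ge
              (ENNReal.inv_le_one.2 (one_le_pow₀ (by norm_num))) hp
        _ = (4⁻¹ : ℝ≥0∞) ^ l := by rw [ENNReal.rpow_one, ENNReal.inv_pow]
        _ ≤ _ := by
          gcongr
          norm_num
    rw [h1, ENNReal.mul_rpow_of_nonneg _ _ hp0]
    calc _ = (((4 : ℝ≥0∞) ^ l)⁻¹) ^ p * (214 * ((K * 20000000 : ℝ≥0∞) / t) ^ p * weight v E) := by
          ring
      _ ≤ _ := by gcongr
  calc _ ≤ _ := weight_mono w hsub
    _ ≤ ∑' l, weight w (S l) := by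
      simp only [weight_eq]
      exact measure_iUnion_le _
    _ ≤ _ := ENNReal.tsum_le_tsum hlevel
    _ = _ := by
      rw [ENNReal.tsum_mul_right, ENNReal.tsum_geometric_two, ENNReal.div_rpow_of_nonneg _ _ hp0,
        ENNReal.mul_rpow_of_nonneg _ _ hp0, weakTypeConst, ENNReal.coe_mul,
        ENNReal.coe_rpow_of_nonneg _ hp0]
      simp only [div_eq_mul_inv]
      push_cast
      ring

theorem ApPlusRestrictedWith.restrictedWeakTypeWith {p : ℝ} (hp : 1 ≤ p)
    {w v : (Fin 2 → ℝ) → ℝ≥0} {K : ℝ≥0} (hK : ApPlusRestrictedWith p w v K) :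
    RestrictedWeakTypeWith p w v (weakTypeConst p * (K : ℝ≥0∞) ^ p) := by
  intro t ht E hE
  -- A measurable subset of full measure has the same maximal function and no larger `v`-mass.
  obtain ⟨E', hE'E, hE', hae⟩ := hE.exists_measurable_subset_ae_eq
  have hM : maximalPlus (E.indicator 1) = maximalPlus (E'.indicator 1) := by
    ext x
    rw [maximalPlus_indicator hE, maximalPlus_indicator hE'.nullMeasurableSet]
    refine iSup_congr fun h => iSup_congr fun _ => ?_
    rw [measure_congr (hae.inter (ae_eq_refl (cube x h)))]
  rw [hM]
  exact (hK.weight_maximalPlus_le hp hE' ht).trans (by gcongr; exact weight_mono v hE'E)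

/-! ### The optimal constant -/

theorem ApPlusRestrictedWith.mono {n : ℕ} {p : ℝ} {w v : (Fin n → ℝ) → ℝ≥0} {K K' : ℝ≥0}
    (hK : ApPlusRestrictedWith p w v K) (h : K ≤ K') : ApPlusRestrictedWith p w v K' :=
  fun a r hr E hE hEa => (hK a r hr E hE hEa).trans (by gcongr)

theorem apPlusRestrictedWith_of_lt {n : ℕ} {p : ℝ} {w v : (Fin n → ℝ) → ℝ≥0} {K : ℝ≥0}
    (h : apPlusConst p w v < K) : ApPlusRestrictedWith p w v K := by
  simp only [apPlusConst, iInf_lt_iff] at h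
  obtain ⟨C, hC, hCK⟩ := h
  exact hC.mono (by exact_mod_cast hCK.le)

/-- The weak type inequality with the optimal constant, for sets of finite `v`-measure. -/
theorem weight_maximalPlus_le_apPlusConst {p : ℝ} (hp : 1 ≤ p) {w v : (Fin 2 → ℝ) → ℝ≥0}
    (hwv : ApPlusRestricted p w v) {t : ℝ≥0} (ht : 0 < t) {E : Set (Fin 2 → ℝ)}
    (hE : NullMeasurableSet E volume) (hv : weight v E ≠ ∞) :
    weight w {x | (t : ℝ≥0∞) < maximalPlus (E.indicator 1) x} ≤
      weakTypeConst p * apPlusConst p w v ^ p / (t : ℝ≥0∞) ^ p * weight v E := by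
  have hp0 : 0 < p := by linarith
  have ht0 : (t : ℝ≥0∞) ^ p ≠ 0 := by simp [ht.ne']
  obtain ⟨K₀, -, hK₀⟩ := hwv
  have hne : apPlusConst p w v ≠ ∞ :=
    ne_top_of_le_ne_top ENNReal.coe_ne_top (iInf₂_le (α := ℝ≥0∞) K₀ hK₀)
  lift apPlusConst p w v to ℝ≥0 using hne with κ hκ
  have hcont : Continuous fun x : ℝ≥0 =>
      weakTypeConst p * (x : ℝ≥0∞) ^ p / (t : ℝ≥0∞) ^ p * weight v E := by
    have hc : (weakTypeConst p : ℝ≥0∞) / (t : ℝ≥0∞) ^ p * weight v E ≠ ∞ :=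
      ENNReal.mul_ne_top (ENNReal.div_ne_top ENNReal.coe_ne_top ht0) hv
    have : (fun x : ℝ≥0 => weakTypeConst p * (x : ℝ≥0∞) ^ p / (t : ℝ≥0∞) ^ p * weight v E) =
        fun x : ℝ≥0 => (weakTypeConst p : ℝ≥0∞) / (t : ℝ≥0∞) ^ p * weight v E * (x : ℝ≥0∞) ^ p := by
      ext x
      simp only [div_eq_mul_inv]
      ring
    rw [this]
    exact (ENNReal.continuous_const_mul hc).comp
      (ENNReal.continuous_rpow_const.comp ENNReal.continuous_coe)
  -- Every `K > κ` is admissible; finiteness of `v(E)` makes the bound continuous in `K`, so `K` may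
  -- decrease to `κ`.
  refine ge_of_tendsto (x := nhdsWithin κ (Set.Ioi κ)) (hcont.continuousWithinAt) ?_
  filter_upwards [self_mem_nhdsWithin] with K hKκ
  refine (apPlusRestrictedWith_of_lt ?_).restrictedWeakTypeWith hp t ht E hE
  rw [← hκ]
  exact_mod_cast hKκ

/-- Infinite `v(E)` is harmless unless the optimal constant is 0. Then the right-hand side is `0 * ∞
= 0`, and the level set has to be shown `w`-null by exhausting `E` with sets of finite `v`-mass. -/
theorem restrictedWeakTypeWith_apPlusConst {p : ℝ} (hp : 1 ≤ p) {w v : (Fin 2 → ℝ) → ℝ≥0}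
    (hvm : AEMeasurable v volume) (hwv : ApPlusRestricted p w v) :
    RestrictedWeakTypeWith p w v (weakTypeConst p * apPlusConst p w v ^ p) := by
  intro t ht E hE
  have hp0 : 0 < p := by linarith
  by_cases hv : weight v E = ∞
  swap
  · exact weight_maximalPlus_le_apPlusConst hp hwv ht hE hv
  have htp : (t : ℝ≥0∞) ^ p ≠ ∞ := ENNReal.rpow_ne_top_of_nonneg hp0.le ENNReal.coe_ne_top
  by_cases h0 : apPlusConst p w v = 0
  swap
  · rw [hv, ENNReal.mul_top]
    · exact le_top
    · refine ENNReal.div_ne_zero.2 ⟨mul_ne_zero ?_ ?_, htp⟩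
      · exact_mod_cast (weakTypeConst_pos p).ne'
      · simp [h0, hp0.le]
  set F : ℕ → Set (Fin 2 → ℝ) := fun n =>
    E ∩ ({y | v y ≤ n} ∩ cube (fun _ => -n) (2 * n)) with hF
  have hFm : ∀ n, NullMeasurableSet (F n) volume := fun n =>
    hE.inter ((nullMeasurableSet_le hvm aemeasurable_const).inter
      (measurableSet_cube _ _).nullMeasurableSet)
  have hFmono : Monotone F := by
    rintro m n hmn y ⟨hyE, hyv, hyc⟩
    have hmn' : (m : ℝ) ≤ n := by exact_mod_cast hmn
    refine ⟨hyE, le_trans (show v y ≤ m from hyv) (by exact_mod_cast hmn), mem_cube.2 fun l => ?_⟩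
    have := mem_cube.1 hyc l
    constructor <;> linarith [this.1, this.2]
  have hFE : ⋃ n, F n = E := by
    refine Set.Subset.antisymm (Set.iUnion_subset fun n => Set.inter_subset_left) fun y hy => ?_
    obtain ⟨n, hn⟩ := exists_nat_gt (max (v y : ℝ) (max |y 0| |y 1|))
    simp only [max_lt_iff, abs_lt] at hn
    refine Set.mem_iUnion.2 ⟨n, hy, ?_, mem_cube.2 fun l => ?_⟩
    · exact_mod_cast hn.1.le
    · fin_cases l <;> constructor <;> simp <;> linarith [hn.2.1.1, hn.2.1.2, hn.2.2.1, hn.2.2.2]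
  have hFv : ∀ n, weight v (F n) ≠ ∞ := by
    intro n
    have hle : weight v (F n) ≤ ∫⁻ x in F n, ((n : ℝ≥0) : ℝ≥0∞) := by
      refine lintegral_mono_ae ((ae_restrict_iff'₀ (hFm n)).2 (Filter.Eventually.of_forall ?_))
      exact fun y hy => ENNReal.coe_le_coe.2 hy.2.1
    refine ne_top_of_le_ne_top ?_ hle
    rw [setLIntegral_const]
    exact ENNReal.mul_ne_top ENNReal.coe_ne_top
      (ne_top_of_le_ne_top (volume_cube_ne_top _ _) (measure_mono fun y hy => hy.2.2))
  have hzero : ∀ n, weight w {x | (t : ℝ≥0∞) < maximalPlus ((F n).indicator 1) x} = 0 := by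
    intro n
    have := weight_maximalPlus_le_apPlusConst hp hwv ht (hFm n) (hFv n)
    simpa [h0, ENNReal.zero_rpow_of_pos hp0] using this
  have hsub : {x | (t : ℝ≥0∞) < maximalPlus (E.indicator 1) x} ⊆
      ⋃ n, {x | (t : ℝ≥0∞) < maximalPlus ((F n).indicator 1) x} := by
    intro x hx
    rw [Set.mem_ofPred_eq, maximalPlus_indicator hE] at hx
    simp only [lt_iSup_iff] at hx
    obtain ⟨h, hh, hx⟩ := hx
    have hsup : volume (E ∩ cube x h) = ⨆ n, volume (F n ∩ cube x h) := by
      rw [← hFE, Set.iUnion_inter, Monotone.measure_iUnion]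
      exact fun m n hmn => Set.inter_subset_inter_left _ (hFmono hmn)
    rw [hsup, ENNReal.mul_iSup, lt_iSup_iff] at hx
    obtain ⟨n, hn⟩ := hx
    refine Set.mem_iUnion.2 ⟨n, ?_⟩
    rw [Set.mem_ofPred_eq, maximalPlus_indicator (hFm n)]
    exact hn.trans_le (le_iSup₂ (f := fun (h : ℝ) (_ : 0 < h) =>
      (volume (cube x h))⁻¹ * volume (F n ∩ cube x h)) h hh)
  have : weight w {x | (t : ℝ≥0∞) < maximalPlus (E.indicator 1) x} = 0 := by
    refine le_antisymm ((weight_mono w hsub).trans ?_) bot_le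
    simp only [weight_eq] at hzero ⊢
    exact (measure_iUnion_null hzero).le
  rw [this]
  exact bot_le

/-! ### Necessity of the condition -/

theorem RestrictedWeakTypeWith.apPlusRestrictedWith {p : ℝ} (hp : 1 ≤ p)
    {w v : (Fin 2 → ℝ) → ℝ≥0} {C : ℝ≥0} (hC : RestrictedWeakTypeWith p w v C) :
    ApPlusRestrictedWith p w v (8 * C ^ (1 / p)) := by
  intro a h hh E hE hEa
  have hp0 : 0 < p := by linarith
  have hEne : volume E ≠ ∞ := ne_top_of_le_ne_top (volume_cube_ne_top _ _) (measure_mono hEa)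
  have hQ0 : volume (cube a h) ≠ 0 := by simp [volume_cube, hh]
  have hQ := volume_cube_ne_top a h
  rcases eq_or_ne (volume E) 0 with h0 | h0
  · simp [h0]
  obtain ⟨s, hs⟩ : ∃ s : ℝ≥0, (s : ℝ≥0∞) = volume E / volume (cube a h) :=
    ⟨_, ENNReal.coe_toNNReal (ENNReal.div_ne_top hEne hQ0)⟩
  have hs0 : 0 < s := by
    have : (s : ℝ≥0∞) ≠ 0 := by rw [hs]; exact ENNReal.div_ne_zero.2 ⟨h0, hQ⟩
    exact pos_iff_ne_zero.2 (by exact_mod_cast this)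
  rw [← hs]
  -- The average over `Q_{x,2h}` is exactly `s / 4`; the level `s / 8` makes the inequality strict.
  have hsub : cube a h ⊆ {x | ((s / 8 : ℝ≥0) : ℝ≥0∞) < maximalPlus (E.indicator 1) x} := by
    intro x hx
    rw [Set.mem_ofPred_eq, maximalPlus_indicator hE]
    refine lt_of_lt_of_le ?_ (le_iSup₂ (f := fun (h : ℝ) (_ : 0 < h) =>
      (volume (cube x h))⁻¹ * volume (E ∩ cube x h)) (2 * h) (by positivity))
    have hE' : E ∩ cube x (2 * h) = E := by
      refine Set.inter_eq_left.2 fun z hz => mem_cube.2 fun l => ?_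
      have h1 := mem_cube.1 (hEa hz) l
      have h2 := mem_cube.1 hx l
      constructor <;> linarith [h1.1, h1.2, h2.1, h2.2]
    have hv : volume (cube x (2 * h)) = 4 * volume (cube a h) := by
      rw [volume_cube, volume_cube, ENNReal.ofReal_mul (by norm_num), mul_pow]
      norm_num
    have h4 : (volume (cube x (2 * h)))⁻¹ * volume E = ((s / 4 : ℝ≥0) : ℝ≥0∞) := by
      rw [hv, ENNReal.mul_inv (Or.inl (by simp)) (Or.inl (by simp)), mul_assoc,
        mul_comm _ (volume E), ← div_eq_mul_inv (volume E), ← hs, ENNReal.coe_div (by simp),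
        div_eq_mul_inv, mul_comm]
      simp
    rw [hE', h4]
    exact_mod_cast div_lt_div_of_pos_left hs0 (by norm_num) (by norm_num)
  have h1 := (weight_mono w hsub).trans (hC (s / 8) (by positivity) E hE)
  have h2 := ENNReal.rpow_le_rpow h1 (by positivity : 0 ≤ 1 / p)
  have hs8 : ((s / 8 : ℝ≥0) : ℝ≥0∞) ≠ 0 := by
    have : s / 8 ≠ 0 := by positivity
    exact_mod_cast this
  rw [ENNReal.mul_rpow_of_nonneg _ _ (by positivity), ENNReal.div_rpow_of_nonneg _ _ (by positivity),
    ← ENNReal.rpow_mul, mul_one_div_cancel hp0.ne', ENNReal.rpow_one] at h2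
  calc (s : ℝ≥0∞) * weight w (cube a h) ^ (1 / p)
      ≤ s * ((C : ℝ≥0∞) ^ (1 / p) / ((s / 8 : ℝ≥0) : ℝ≥0∞) * weight v E ^ (1 / p)) := by gcongr
    _ = _ := by
      have h8 : (s : ℝ≥0∞) = 8 * ((s / 8 : ℝ≥0) : ℝ≥0∞) := by
        rw [show (8 : ℝ≥0∞) = ((8 : ℝ≥0) : ℝ≥0∞) by simp, ← ENNReal.coe_mul]
        congr 1
        field_simp
      rw [ENNReal.coe_mul, ENNReal.coe_rpow_of_nonneg _ (by positivity : 0 ≤ 1 / p), h8,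
        div_eq_mul_inv ((C : ℝ≥0∞) ^ (1 / p))]
      calc _ = 8 * (((s / 8 : ℝ≥0) : ℝ≥0∞) * ((s / 8 : ℝ≥0) : ℝ≥0∞)⁻¹) *
            ((C : ℝ≥0∞) ^ (1 / p)) * weight v E ^ (1 / p) := by ring
        _ = _ := by
          rw [ENNReal.mul_inv_cancel hs8 ENNReal.coe_ne_top]
          simp

end OneSided

theorem theorem2 (p : ℝ) (hp : 1 ≤ p) :
    (∀ w v : (Fin 2 → ℝ) → ℝ≥0, AEMeasurable w volume → AEMeasurable v volume →
      (OneSided.RestrictedWeakType p w v ↔ OneSided.ApPlusRestricted p w v)) ∧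
    ∃ C : ℝ≥0, 0 < C ∧
      ∀ w v : (Fin 2 → ℝ) → ℝ≥0, AEMeasurable w volume → AEMeasurable v volume →
        OneSided.ApPlusRestricted p w v →
          OneSided.RestrictedWeakTypeWith p w v
            ((C : ℝ≥0∞) * OneSided.apPlusConst p w v ^ p) := by
  refine ⟨fun w v _ _ => ⟨?_, ?_⟩, OneSided.weakTypeConst p, OneSided.weakTypeConst_pos p,
    fun w v _ hv h => OneSided.restrictedWeakTypeWith_apPlusConst hp hv h⟩
  · rintro ⟨C, hC0, hC⟩
    exact ⟨8 * C ^ (1 / p), mul_pos (by norm_num) (NNReal.rpow_pos hC0),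
      hC.apPlusRestrictedWith hp⟩
  · rintro ⟨K, hK0, hK⟩
    refine ⟨OneSided.weakTypeConst p * K ^ p,
      mul_pos (OneSided.weakTypeConst_pos p) (NNReal.rpow_pos hK0), ?_⟩
    rw [ENNReal.coe_mul, ENNReal.coe_rpow_of_nonneg _ (by linarith)]
    exact hK.restrictedWeakTypeWith hp
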